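/- Let $A\in\mathbb{R}^{n\times n}$ be a symmetric matrix whose spectrum is contained in $[0,1]$, and let $\bm w\in\mathbb{R}^n$ with Euclidean norm $\|\bm w\|=1$. Let $\sigma$ be the entire function with $\sigma(x^2)=\sin(x)/x$, $\sigma(0)=1$. Let $V_m$ be the matrix whose columns are the first $m$ vectors of the Lanczos process for $A$ with starting vector $\bm w$ (if the process breaks down before it has produced $m$ vectors, the missing columns are set to zero), let $H_m=V_m^TAV_m$, and let $$\bm y_m(t)=V_m\,t\,\sigma(t^2H_m)\,\bm e_1$$ be the Lanczos approximation to $\bm y(t)=t\,\sigma(t^2A)\bm w=\frac{\sin(t\sqrt A)}{\sqrt A}\bm w$, which is the solution of $\bm y''=-A\bm y$, $\bm y(0)=0$, $\bm y'(0)=\bm w$. Let $$\bm r_m(t)=-A\bm y_m(t)-\bm y_m''(t)$$ be its residual. If $0\le t\le 1$ and $m\ge 2$, then $$\|\bm r_m(t)\|\le 16\cdot\frac{(t/2)^{2m-1}}{(2m-1)!},$$ where $\|\cdot\|$ is the Euclidean norm. -/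

import Mathlib

/-- The entire function `σ` with `σ (x ^ 2) = sin x / x` and `σ 0 = 1`, on the real line,
given by its Maclaurin series. -/
noncomputable def sigmaFun (z : ℝ) : ℝ :=
  ∑' k : ℕ, (-1) ^ k * z ^ k / ((2 * k + 1).factorial : ℝ)

/-- The defining property of `σ`; `Real.sinc x` is `sin x / x` for `x ≠ 0`, and `1` for `x = 0`. -/
theorem sigmaFun_sq (x : ℝ) : sigmaFun (x ^ 2) = Real.sinc x := by
  unfold sigmaFun
  rcases eq_or_ne x 0 with rfl | hx
  · rw [tsum_eq_single 0]
    · simp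
    · intro k hk
      simp [hk]
  · rw [Real.sinc_of_ne_zero hx]
    have h := ((Real.hasSum_sin x).div_const x).tsum_eq
    rw [← h]
    refine tsum_congr fun k => ?_
    field_simp
    ring

section Lanczos

variable {n : ℕ}

/-- The vectors of the Lanczos process for `A` and starting vector `w`, before normalization.
With `q j = u j / ‖u j‖` the recurrence is
`u 0 = w`, `u 1 = A (q 0) - ⟪q 0, A (q 0)⟫ q 0`,
`u (j+2) = A (q (j+1)) - ⟪q (j+1), A (q (j+1))⟫ q (j+1) - ‖u (j+1)‖ q j`.
Here `‖u (j+1)‖` is the subdiagonal entry produced by the preceding step. When the process breaks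
down, that is `u j = 0` for some `j`, all the later vectors are `0` as well. -/
noncomputable def lanczosRaw (A : Matrix (Fin n) (Fin n) ℝ) (w : EuclideanSpace ℝ (Fin n)) :
    ℕ → EuclideanSpace ℝ (Fin n)
  | 0 => w
  | 1 =>
    let q := ‖w‖⁻¹ • w
    Matrix.toEuclideanLin A q - (inner ℝ q (Matrix.toEuclideanLin A q)) • q
  | j + 2 =>
    let p := lanczosRaw A w j
    let u := lanczosRaw A w (j + 1)
    let q := ‖u‖⁻¹ • u
    Matrix.toEuclideanLin A q - (inner ℝ q (Matrix.toEuclideanLin A q)) • q - ‖u‖ • (‖p‖⁻¹ • p)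

/-- The Lanczos vectors, indexed from `0`: the vector with index `j` is the `(j+1)`st basis vector
of the Krylov subspace (or `0`, if the process has broken down before). -/
noncomputable def lanczosVec (A : Matrix (Fin n) (Fin n) ℝ) (w : EuclideanSpace ℝ (Fin n))
    (j : ℕ) : EuclideanSpace ℝ (Fin n) :=
  ‖lanczosRaw A w j‖⁻¹ • lanczosRaw A w j

/-- The matrix `V_m` with columns the first `m` Lanczos vectors. -/
noncomputable def lanczosV (A : Matrix (Fin n) (Fin n) ℝ) (w : EuclideanSpace ℝ (Fin n)) (m : ℕ) :
    Matrix (Fin n) (Fin m) ℝ :=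
  Matrix.of fun i j => lanczosVec A w (j : ℕ) i

/-- The projected matrix `H_m = V_mᵀ A V_m`. -/
noncomputable def lanczosH (A : Matrix (Fin n) (Fin n) ℝ) (w : EuclideanSpace ℝ (Fin n)) (m : ℕ) :
    Matrix (Fin m) (Fin m) ℝ :=
  (lanczosV A w m).transpose * A * lanczosV A w m

/-- The Lanczos approximation `y_m(t) = V_m f(H_m) (β e₁)` to `f(A) w`, where `β = ‖w‖` and
`f(z) = t σ(t² z) = sin (t √z) / √z`. The matrix function of the symmetric matrix `H_m` is
given by the continuous functional calculus. -/
noncomputable def lanczosApprox (A : Matrix (Fin n) (Fin n) ℝ) (w : EuclideanSpace ℝ (Fin n))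
    (m : ℕ) (t : ℝ) : EuclideanSpace ℝ (Fin n) :=
  WithLp.toLp 2 ((lanczosV A w m).mulVec
    ((cfc (fun z : ℝ => t * sigmaFun (t ^ 2 * z)) (lanczosH A w m)).mulVec
      (fun i : Fin m => if (i : ℕ) = 0 then ‖w‖ else 0)))

/-- The residual `r_m(t) = -A y_m(t) - y_m''(t)` of the Lanczos approximation with respect to
the initial value problem `y'' = -A y`, `y 0 = 0`, `y' 0 = w`, whose solution is `t σ(t² A) w`. -/
noncomputable def lanczosResidual (A : Matrix (Fin n) (Fin n) ℝ) (w : EuclideanSpace ℝ (Fin n))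
    (m : ℕ) (t : ℝ) : EuclideanSpace ℝ (Fin n) :=
  -Matrix.toEuclideanLin A (lanczosApprox A w m t) - deriv (deriv (lanczosApprox A w m)) t

end Lanczos

/-! Let `N = m - 1`. On the Krylov space, `A V = V H` up to a multiple of the next unnormalized
vector `u`, so the terms in `V H` cancel against the second derivative. The residual is `-c(t) u`,
with `c(t)` the corner entry (last row, first column) of `t σ(t² H)`, and `‖u‖ ≤ 1`
(`lanczosResidual_eq_smul`, `norm_lanczosRaw_succ_le`).

In an eigenbasis of `H`, `c(t)` integrates `t σ(t² z)` against a signed measure on `[0, 1]` of total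
variation at most `1`. Its `k`-th moment is the corner entry of `H ^ k`, which vanishes for `k < N`
because each factor of `H` reaches only one place below the diagonal.

Bounding the later moments by `1` would lose the factor `4 ^ (-N)`. Expanding monomials in shifted
Chebyshev polynomials recovers it, since those of degree below `N` drop out (`abs_sum_mul_pow_le`).
Summing the Maclaurin series of `σ` from index `N` on gives the bound (`abs_sum_mul_sigmaFun_le`).
-/

open Polynomial in
/-- Chebyshev polynomials are bounded by `1` in absolute value on `[-1, 1]`. -/
theorem abs_eval_chebyshevT_le_one (n : ℤ) {y : ℝ} (h₁ : -1 ≤ y) (h₂ : y ≤ 1) :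
    |(Chebyshev.T ℝ n).eval y| ≤ 1 := by
  rw [← Real.cos_arccos h₁ h₂, Chebyshev.T_real_cos]
  exact Real.abs_cos_le_one _

/-! ### Signed measures on `[0, 1]` with vanishing low moments -/

section Moments

variable {ι : Type*} [Fintype ι]

/-- A signed measure that annihilates the monomials of degree less than `N` annihilates all
polynomials of degree less than `N`. -/
theorem sum_mul_eval_eq_zero {c l : ι → ℝ} {N : ℕ}
    (h0 : ∀ k < N, ∑ i, c i * l i ^ k = 0) (p : Polynomial ℝ) (hp : p.natDegree < N) :
    ∑ i, c i * p.eval (l i) = 0 := by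
  simp_rw [Polynomial.eval_eq_sum_range, Finset.mul_sum]
  rw [Finset.sum_comm]
  refine Finset.sum_eq_zero fun k hk => ?_
  have hk' : k < N := by
    have := Finset.mem_range.1 hk
    omega
  calc ∑ i, c i * (p.coeff k * l i ^ k) = p.coeff k * ∑ i, c i * l i ^ k := by
        rw [Finset.mul_sum]
        exact Finset.sum_congr rfl fun i _ => by ring
    _ = 0 := by rw [h0 k hk', mul_zero]

/-- Below degree `N` the integral vanishes; from degree `N` on, the trivial bound `1` is at most `ρ
^ (|n| - N)`. The form symmetric in `n` and `-n` is the one that the Chebyshev recurrence preserves.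
-/
theorem abs_sum_mul_chebyshevT_le {c l : ι → ℝ} (hc : ∑ i, |c i| ≤ 1)
    (hl : ∀ i, l i ∈ Set.Icc (0 : ℝ) 1) {N : ℕ} (h0 : ∀ k < N, ∑ i, c i * l i ^ k = 0)
    {ρ : ℝ} (hρ : 1 ≤ ρ) (n : ℤ) :
    |∑ i, c i * (Polynomial.Chebyshev.T ℝ n).eval (2 * l i - 1)|
      ≤ (ρ ^ N)⁻¹ * (ρ ^ n + ρ ^ (-n)) := by
  have hρ0 : 0 < ρ := by linarith
  rcases lt_or_ge n.natAbs N with hn | hn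
  · have h := sum_mul_eval_eq_zero h0
      ((Polynomial.Chebyshev.T ℝ n).comp (Polynomial.C 2 * Polynomial.X - Polynomial.C 1)) (by
        refine lt_of_le_of_lt Polynomial.natDegree_comp_le ?_
        rw [Polynomial.Chebyshev.natDegree_T]
        have : (Polynomial.C (2 : ℝ) * Polynomial.X - Polynomial.C 1).natDegree ≤ 1 := by
          compute_degree
        exact lt_of_le_of_lt (Nat.mul_le_mul_left _ this) (by omega))
    simp only [Polynomial.eval_comp, Polynomial.eval_sub, Polynomial.eval_mul,
      Polynomial.eval_C, Polynomial.eval_X] at h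
    rw [h, abs_zero]
    positivity
  · have h1 : |∑ i, c i * (Polynomial.Chebyshev.T ℝ n).eval (2 * l i - 1)| ≤ 1 := by
      refine (Finset.abs_sum_le_sum_abs _ _).trans (le_trans (Finset.sum_le_sum fun i _ => ?_) hc)
      rw [abs_mul]
      exact mul_le_of_le_one_right (abs_nonneg _)
        (abs_eval_chebyshevT_le_one n (by linarith [(hl i).1]) (by linarith [(hl i).2]))
    have h2 : ρ ^ N ≤ ρ ^ n + ρ ^ (-n) := by
      have h3 : ρ ^ N ≤ ρ ^ n.natAbs := pow_le_pow_right₀ hρ hn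
      rw [← zpow_natCast ρ n.natAbs, Int.natCast_natAbs] at h3
      rcases abs_choice n with h | h <;> rw [h] at h3
      · linarith [zpow_pos hρ0 (-n)]
      · linarith [zpow_pos hρ0 n]
    refine h1.trans ?_
    rw [inv_mul_eq_div, le_div_iff₀ (by positivity), one_mul]
    exact h2

/-- With `y = 2x - 1`, multiplication by `4x = 2y + 2` sends `T n` to `T (n+1) + 2 T n + T (n-1)`.
The majorant `ρ ^ n + ρ ^ (-n)` is an eigenvector of this operation, with eigenvalue `ρ + 2 + ρ⁻¹`.
-/
theorem abs_sum_mul_pow_mul_chebyshevT_le {c l : ι → ℝ} (hc : ∑ i, |c i| ≤ 1)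
    (hl : ∀ i, l i ∈ Set.Icc (0 : ℝ) 1) {N : ℕ} (h0 : ∀ k < N, ∑ i, c i * l i ^ k = 0)
    {ρ : ℝ} (hρ : 1 ≤ ρ) (k : ℕ) (n : ℤ) :
    |∑ i, c i * ((4 * l i) ^ k * (Polynomial.Chebyshev.T ℝ n).eval (2 * l i - 1))|
      ≤ (ρ ^ N)⁻¹ * (ρ + 2 + ρ⁻¹) ^ k * (ρ ^ n + ρ ^ (-n)) := by
  have hρ0 : 0 < ρ := by linarith
  induction k generalizing n with
  | zero => simpa using abs_sum_mul_chebyshevT_le hc hl h0 hρ n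
  | succ k ih =>
    have hT : ∀ y : ℝ, (Polynomial.Chebyshev.T ℝ (n + 1)).eval y
        = 2 * y * (Polynomial.Chebyshev.T ℝ n).eval y
          - (Polynomial.Chebyshev.T ℝ (n - 1)).eval y := fun y => by
      rw [Polynomial.Chebyshev.T_add_one]; simp
    set S : ℤ → ℝ := fun n =>
      ∑ i, c i * ((4 * l i) ^ k * (Polynomial.Chebyshev.T ℝ n).eval (2 * l i - 1)) with hS
    have hrec : ∑ i, c i * ((4 * l i) ^ (k + 1) *
        (Polynomial.Chebyshev.T ℝ n).eval (2 * l i - 1)) = S (n + 1) + 2 * S n + S (n - 1) := by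
      simp only [hS, Finset.mul_sum, ← Finset.sum_add_distrib]
      refine Finset.sum_congr rfl fun i _ => ?_
      rw [hT]
      ring
    rw [hrec]
    have e1 := ih (n + 1)
    have e2 := ih n
    have e3 := ih (n - 1)
    have tri : |S (n + 1) + 2 * S n + S (n - 1)| ≤ |S (n + 1)| + 2 * |S n| + |S (n - 1)| := by
      refine (abs_add_le _ _).trans (add_le_add_left ((abs_add_le _ _).trans ?_) _)
      rw [abs_mul, abs_two]
    refine (tri.trans (add_le_add (add_le_add e1
      (mul_le_mul_of_nonneg_left e2 zero_le_two)) e3)).trans (le_of_eq ?_)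
    have z1 : ρ ^ (n + 1) = ρ ^ n * ρ := zpow_add_one₀ hρ0.ne' n
    have z2 : ρ ^ (n - 1) = ρ ^ n * ρ⁻¹ := zpow_sub_one₀ hρ0.ne' n
    have z3 : ρ ^ (-(n + 1)) = ρ ^ (-n) * ρ⁻¹ := by
      rw [neg_add, ← sub_eq_add_neg, zpow_sub_one₀ hρ0.ne']
    have z4 : ρ ^ (-(n - 1)) = ρ ^ (-n) * ρ := by
      rw [neg_sub, sub_eq_neg_add, zpow_add_one₀ hρ0.ne']
    rw [z1, z2, z3, z4]
    ring

/-- If a signed measure on `[0, 1]` of total variation at most `1` annihilates the polynomials of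
degree less than `N`, then its moments are small. -/
theorem abs_sum_mul_pow_le {c l : ι → ℝ} (hc : ∑ i, |c i| ≤ 1)
    (hl : ∀ i, l i ∈ Set.Icc (0 : ℝ) 1) {N : ℕ} (h0 : ∀ k < N, ∑ i, c i * l i ^ k = 0)
    {ρ : ℝ} (hρ : 1 ≤ ρ) (k : ℕ) :
    |∑ i, c i * l i ^ k| ≤ 2 * (ρ ^ N)⁻¹ * ((ρ + 2 + ρ⁻¹) / 4) ^ k := by
  have h := abs_sum_mul_pow_mul_chebyshevT_le hc hl h0 hρ k 0
  have e : ∑ i, c i * ((4 * l i) ^ k * (Polynomial.Chebyshev.T ℝ 0).eval (2 * l i - 1))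
      = 4 ^ k * ∑ i, c i * l i ^ k := by
    rw [Finset.mul_sum]
    refine Finset.sum_congr rfl fun i _ => ?_
    simp [mul_pow]
    ring
  rw [e, abs_mul, abs_of_pos (by positivity : (0 : ℝ) < 4 ^ k)] at h
  simp only [zpow_zero, neg_zero] at h
  rw [div_pow, ← mul_div_assoc, le_div_iff₀ (by positivity)]
  linarith

/-! ### Estimate of the series tail -/

theorem factorial_mul_pow_le_factorial (N l : ℕ) (hN : 1 ≤ N) :
    (2 * N + 1).factorial * (4 * (2 * N + 3)) ^ l ≤ (2 * (N + l) + 1).factorial := by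
  induction l with
  | zero => simp
  | succ l ih =>
    have e : 2 * (N + (l + 1)) + 1 = 2 * (N + l) + 1 + 1 + 1 := by ring
    rw [e, Nat.factorial_succ (2 * (N + l) + 1 + 1), Nat.factorial_succ (2 * (N + l) + 1),
      pow_succ, ← mul_assoc, mul_comm]
    calc 4 * (2 * N + 3) * ((2 * N + 1).factorial * (4 * (2 * N + 3)) ^ l)
        ≤ ((2 * (N + l) + 1 + 1) * (2 * (N + l) + 1 + 1 + 1)) * (2 * (N + l) + 1).factorial :=
          Nat.mul_le_mul (Nat.mul_le_mul (by omega) (by omega)) ih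
      _ = _ := by ring

/-- The series defining `sigmaFun` converges. -/
theorem hasSum_sigmaFun (z : ℝ) :
    HasSum (fun k : ℕ => (-1) ^ k * z ^ k / ((2 * k + 1).factorial : ℝ)) (sigmaFun z) := by
  refine Summable.hasSum ?_
  refine Summable.of_norm_bounded (Real.summable_pow_div_factorial |z|) fun k => ?_
  rw [norm_div, norm_mul, norm_pow, norm_pow, norm_neg, norm_one, one_pow, one_mul,
    Real.norm_eq_abs, Real.norm_of_nonneg (by positivity)]
  gcongr
  omega

theorem one_add_inv_pow_le (M : ℕ) : (1 + (M : ℝ)⁻¹) ^ M ≤ 2.72 := by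
  rcases Nat.eq_zero_or_pos M with rfl | hM
  · norm_num
  have h : (1 + (M : ℝ)⁻¹) ^ M ≤ Real.exp 1 := by
    calc (1 + (M : ℝ)⁻¹) ^ M ≤ (Real.exp (M : ℝ)⁻¹) ^ M := by
          gcongr
          linarith [Real.add_one_le_exp (M : ℝ)⁻¹]
      _ = Real.exp 1 := by
          rw [← Real.exp_nat_mul, mul_inv_cancel₀ (by positivity)]
  linarith [Real.exp_one_lt_d9]

/-- The bound for `t σ(t² z)` integrated against a signed measure on `[0, 1]` that annihilates the
polynomials of degree less than `N`. -/
theorem abs_sum_mul_sigmaFun_le {c l : ι → ℝ} (hc : ∑ i, |c i| ≤ 1)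
    (hl : ∀ i, l i ∈ Set.Icc (0 : ℝ) 1) {N : ℕ} (hN : 1 ≤ N)
    (h0 : ∀ k < N, ∑ i, c i * l i ^ k = 0) {t : ℝ} (ht0 : 0 ≤ t) (ht1 : t ≤ 1) :
    |∑ i, c i * (t * sigmaFun (t ^ 2 * l i))|
      ≤ 16 * ((t / 2) ^ (2 * N + 1) / ((2 * N + 1).factorial : ℝ)) := by
  set μ : ℕ → ℝ := fun k => ∑ i, c i * l i ^ k with hμ
  set a : ℕ → ℝ := fun k => (-1) ^ k * t ^ (2 * k + 1) / ((2 * k + 1).factorial : ℝ) * μ k with ha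
  have hsum : HasSum a (∑ i, c i * (t * sigmaFun (t ^ 2 * l i))) := by
    have h := hasSum_sum (s := Finset.univ)
      fun i _ => ((hasSum_sigmaFun (t ^ 2 * l i)).mul_left t).mul_left (c i)
    convert! h using 1
    funext k
    simp only [ha, hμ, Finset.mul_sum]
    refine Finset.sum_congr rfl fun i _ => ?_
    rw [mul_pow, ← pow_mul]
    ring
  rw [← hasSum_nat_add_iff' N, Finset.sum_eq_zero (s := Finset.range N), sub_zero] at hsum
  swap
  · intro k hk
    simp only [ha, hμ]
    rw [h0 k (Finset.mem_range.1 hk), mul_zero]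
  -- The factor `2` is `ρ ^ 0 + ρ ^ (-0)` from the moment bound, and `2.72` bounds `e`.
  set B : ℝ := t ^ (2 * N + 1) / ((2 * N + 1).factorial : ℝ) * (2 * 2.72 / 4 ^ N) with hB
  have hgeo : HasSum (fun k : ℕ => B * (1 / 16 : ℝ) ^ k) (B * (1 - 1 / 16)⁻¹) :=
    (hasSum_geometric_of_lt_one (by norm_num) (by norm_num)).mul_left B
  have hbound : ∀ k, ‖a (k + N)‖ ≤ B * (1 / 16 : ℝ) ^ k := by
    intro k
    have hNr : (1 : ℝ) ≤ N := by exact_mod_cast hN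
    -- As `ρ + 2 + ρ⁻¹ = ρ (1 + ρ⁻¹) ^ 2`, a large `ρ` favours the moment of order `N` but worsens
    -- the growth of the later ones. With `ρ = 2N` the former costs at most `e`, and the growth
    -- ratio is at most `(2N + 3) / 4`, which the factorials absorb, leaving `1 / 16`.
    set ρ : ℝ := ((2 * N : ℕ) : ℝ) with hρ
    have hρ2 : ρ = 2 * N := by rw [hρ]; push_cast; ring
    have hρ1 : 1 ≤ ρ := by linarith
    have hρ0 : 0 < ρ := by linarith
    have hm := abs_sum_mul_pow_le hc hl h0 hρ1 (k + N)
    have hq : ρ + 2 + ρ⁻¹ ≤ 2 * N + 3 := by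
      have : ρ⁻¹ ≤ 1 := inv_le_one_of_one_le₀ hρ1
      linarith
    have hN2 : (ρ ^ N)⁻¹ * ((ρ + 2 + ρ⁻¹) / 4) ^ N ≤ 2.72 / 4 ^ N := by
      have e : ρ + 2 + ρ⁻¹ = ρ * (1 + ρ⁻¹) ^ 2 := by field_simp; ring
      rw [e, div_pow, mul_pow, ← pow_mul, ← mul_div_assoc, ← mul_assoc,
        inv_mul_cancel₀ (by positivity), one_mul]
      exact div_le_div_of_nonneg_right (one_add_inv_pow_le (2 * N)) (by positivity)
    have hμk : |μ (k + N)| ≤ 2 * 2.72 / 4 ^ N * ((2 * N + 3) / 4) ^ k := by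
      refine hm.trans ?_
      calc 2 * (ρ ^ N)⁻¹ * ((ρ + 2 + ρ⁻¹) / 4) ^ (k + N)
          = 2 * ((ρ ^ N)⁻¹ * ((ρ + 2 + ρ⁻¹) / 4) ^ N) * ((ρ + 2 + ρ⁻¹) / 4) ^ k := by
            rw [pow_add]; ring
        _ ≤ 2 * (2.72 / 4 ^ N) * ((2 * N + 3) / 4) ^ k := by gcongr
        _ = _ := by ring
    have hfac : ((2 * N + 1).factorial : ℝ) * (4 * (2 * N + 3)) ^ k
        ≤ ((2 * (k + N) + 1).factorial : ℝ) := by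
      rw [add_comm k N]
      exact_mod_cast factorial_mul_pow_le_factorial N k hN
    have htk : t ^ (2 * (k + N) + 1) ≤ t ^ (2 * N + 1) :=
      pow_le_pow_of_le_one ht0 ht1 (by omega)
    rw [Real.norm_eq_abs]
    simp only [ha]
    rw [abs_mul, abs_div, abs_mul, abs_pow, abs_neg, abs_one, one_pow, one_mul,
      abs_of_nonneg (by positivity : 0 ≤ t ^ (2 * (k + N) + 1)),
      abs_of_nonneg (by positivity : (0 : ℝ) ≤ ((2 * (k + N) + 1).factorial : ℝ))]
    calc t ^ (2 * (k + N) + 1) / ((2 * (k + N) + 1).factorial : ℝ) * |μ (k + N)|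
        ≤ t ^ (2 * N + 1) / (((2 * N + 1).factorial : ℝ) * (4 * (2 * N + 3)) ^ k)
            * (2 * 2.72 / 4 ^ N * ((2 * N + 3) / 4) ^ k) := by gcongr
      _ = B * (1 / 16 : ℝ) ^ k := by
          rw [hB, mul_pow, div_pow, div_pow, one_pow, show (16 : ℝ) = 4 * 4 by norm_num, mul_pow]
          field_simp
  have hfin := hsum.norm_le_of_bounded hgeo hbound
  rw [Real.norm_eq_abs] at hfin
  refine hfin.trans ?_
  have e : 16 * ((t / 2) ^ (2 * N + 1) / ((2 * N + 1).factorial : ℝ))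
      = t ^ (2 * N + 1) / ((2 * N + 1).factorial : ℝ) * (8 / 4 ^ N) := by
    rw [div_pow, pow_succ (2 : ℝ), pow_mul (2 : ℝ)]
    norm_num
    field_simp
    ring
  -- What remains is `2 · 2.72 · 16 / 15 ≤ 8`.
  rw [e, hB, mul_assoc]
  gcongr
  rw [div_mul_eq_mul_div]
  gcongr
  norm_num

end Moments

/-! ### Orthogonality and the Lanczos relation -/

section LanczosProcess

variable {n : ℕ}

theorem norm_smul_lanczosVec (A : Matrix (Fin n) (Fin n) ℝ) (w : EuclideanSpace ℝ (Fin n))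
    (j : ℕ) : ‖lanczosRaw A w j‖ • lanczosVec A w j = lanczosRaw A w j := by
  unfold lanczosVec
  rcases eq_or_ne (lanczosRaw A w j) 0 with h | h
  · simp [h]
  · rw [smul_smul, mul_inv_cancel₀ (norm_ne_zero_iff.2 h), one_smul]

/-- Replaces normalization: it holds for unit vectors and for the zero vectors after a breakdown
alike. -/
theorem norm_sq_smul_lanczosVec (A : Matrix (Fin n) (Fin n) ℝ) (w : EuclideanSpace ℝ (Fin n))
    (j : ℕ) : ‖lanczosVec A w j‖ ^ 2 • lanczosVec A w j = lanczosVec A w j := by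
  rcases eq_or_ne (lanczosRaw A w j) 0 with h | h
  · simp [lanczosVec, h]
  · have : ‖lanczosVec A w j‖ = 1 := by
      rw [lanczosVec, norm_smul, norm_inv, norm_norm, inv_mul_cancel₀ (norm_ne_zero_iff.2 h)]
    rw [this, one_pow, one_smul]

theorem norm_lanczosVec_le_one (A : Matrix (Fin n) (Fin n) ℝ) (w : EuclideanSpace ℝ (Fin n))
    (j : ℕ) : ‖lanczosVec A w j‖ ≤ 1 := by
  rw [lanczosVec, norm_smul, norm_inv, norm_norm]
  exact inv_mul_le_one

/-- After a breakdown all further vectors vanish. -/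
theorem lanczosRaw_succ_eq_zero (A : Matrix (Fin n) (Fin n) ℝ)
    (w : EuclideanSpace ℝ (Fin n)) {j : ℕ} (h : lanczosRaw A w j = 0) :
    lanczosRaw A w (j + 1) = 0 := by
  cases j with
  | zero =>
    have h' : w = 0 := by simpa [lanczosRaw] using h
    simp [lanczosRaw, h']
  | succ j => rw [lanczosRaw]; simp [h]

theorem toEuclideanLin_lanczosVec_zero (A : Matrix (Fin n) (Fin n) ℝ)
    (w : EuclideanSpace ℝ (Fin n)) :
    Matrix.toEuclideanLin A (lanczosVec A w 0) =
      (inner ℝ (lanczosVec A w 0) (Matrix.toEuclideanLin A (lanczosVec A w 0))) •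
        lanczosVec A w 0 + lanczosRaw A w 1 := by
  simp only [lanczosVec, lanczosRaw]
  abel

theorem toEuclideanLin_lanczosVec_succ (A : Matrix (Fin n) (Fin n) ℝ)
    (w : EuclideanSpace ℝ (Fin n)) (j : ℕ) :
    Matrix.toEuclideanLin A (lanczosVec A w (j + 1)) =
      (inner ℝ (lanczosVec A w (j + 1)) (Matrix.toEuclideanLin A (lanczosVec A w (j + 1)))) •
        lanczosVec A w (j + 1) + ‖lanczosRaw A w (j + 1)‖ • lanczosVec A w j
        + lanczosRaw A w (j + 2) := by
  rw [lanczosRaw]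
  simp only [lanczosVec]
  abel

theorem inner_toEuclideanLin_lanczosVec (A : Matrix (Fin n) (Fin n) ℝ)
    (w : EuclideanSpace ℝ (Fin n)) {j : ℕ} {x : EuclideanSpace ℝ (Fin n)}
    (hx : ∀ i ≤ j, inner ℝ (lanczosVec A w i) x = 0) :
    inner ℝ (Matrix.toEuclideanLin A (lanczosVec A w j)) x = inner ℝ (lanczosRaw A w (j + 1)) x := by
  cases j with
  | zero =>
    rw [toEuclideanLin_lanczosVec_zero, inner_add_left, inner_smul_left, hx 0 le_rfl]
    simp
  | succ j =>
    rw [toEuclideanLin_lanczosVec_succ, inner_add_left, inner_add_left, inner_smul_left,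
      inner_smul_left, hx _ le_rfl, hx j (Nat.le_succ j)]
    simp

theorem inner_toEuclideanLin_comm {A : Matrix (Fin n) (Fin n) ℝ} (hA : A.IsSymm)
    (x y : EuclideanSpace ℝ (Fin n)) :
    inner ℝ (Matrix.toEuclideanLin A x) y = inner ℝ x (Matrix.toEuclideanLin A y) :=
  Matrix.isSymmetric_toEuclideanLin_iff.2
    (by rw [Matrix.IsHermitian, Matrix.conjTranspose_eq_transpose_of_trivial]; exact hA) x y

/-- By symmetry `A` moves onto the earlier vector `q i`, and `A q i` agrees with `u (i+1)` up to `q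
i` and `q (i-1)`. Hence only the last two vectors need to be subtracted explicitly, and `‖u (k+1)‖`
is the right coefficient for `q k`. -/
theorem inner_lanczosVec_lanczosRaw_of_lt {A : Matrix (Fin n) (Fin n) ℝ} (hA : A.IsSymm)
    (w : EuclideanSpace ℝ (Fin n)) (k : ℕ) :
    ∀ i < k, inner ℝ (lanczosVec A w i) (lanczosRaw A w k) = 0 := by
  induction k using Nat.strong_induction_on with
  | _ k ih =>
  have ih' : ∀ j < k, ∀ i < j, inner ℝ (lanczosVec A w i) (lanczosVec A w j) = 0 := by
    intro j hj i hi
    rw [lanczosVec.eq_def A w j, inner_smul_right, ih j hj i hi, mul_zero]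
  have hself : ∀ j, ∀ x, inner ℝ (lanczosVec A w j) (inner ℝ (lanczosVec A w j) x •
      lanczosVec A w j) = inner ℝ (lanczosVec A w j) x := by
    intro j x
    rw [inner_smul_right, real_inner_self_eq_norm_sq, mul_comm, ← real_inner_smul_left,
      norm_sq_smul_lanczosVec]
  intro i hi
  match k, ih, ih', hi with
  | 1, _, _, hi =>
    obtain rfl : i = 0 := by omega
    have h := congrArg (inner ℝ (lanczosVec A w 0)) (toEuclideanLin_lanczosVec_zero A w)
    rw [inner_add_right, hself] at h
    linarith
  | k + 2, ih, ih', hi =>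
    have h := congrArg (inner ℝ (lanczosVec A w i)) (toEuclideanLin_lanczosVec_succ A w k)
    rw [inner_add_right, inner_add_right] at h
    rcases Nat.lt_or_ge k i with h1 | h1
    · obtain rfl : i = k + 1 := by omega
      have h0 : inner ℝ (lanczosVec A w (k + 1)) (lanczosVec A w k) = 0 := by
        rw [real_inner_comm]
        exact ih' (k + 1) (by omega) k (by omega)
      rw [hself, inner_smul_right _ (lanczosVec A w k), h0] at h
      linarith
    · rw [inner_smul_right _ (lanczosVec A w (k + 1)), ih' (k + 1) (by omega) i (by omega),
        mul_zero, zero_add, ← inner_toEuclideanLin_comm hA,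
        inner_toEuclideanLin_lanczosVec A w
          (fun l hl => ih' (k + 1) (by omega) l (by omega)), inner_smul_right] at h
      rcases Nat.lt_or_ge i k with h2 | h2
      · rw [ih' k (by omega) i h2, mul_zero, zero_add] at h
        rw [← h, ← norm_smul_lanczosVec, real_inner_smul_left,
          ih' (k + 1) (by omega) (i + 1) (by omega), mul_zero]
      · obtain rfl : i = k := by omega
        have e1 : inner ℝ (lanczosRaw A w (i + 1)) (lanczosVec A w (i + 1))
            = ‖lanczosRaw A w (i + 1)‖ := by
          rcases eq_or_ne (lanczosRaw A w (i + 1)) 0 with h0 | h0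
          · simp [h0]
          · rw [lanczosVec, real_inner_smul_right, real_inner_self_eq_norm_sq]
            have := norm_ne_zero_iff.2 h0
            field_simp
        -- If `q i = 0`, its norm is not `1`, but then `u (i+1) = 0` and both sides vanish.
        have e2 : ‖lanczosRaw A w (i + 1)‖ * inner ℝ (lanczosVec A w i) (lanczosVec A w i)
            = ‖lanczosRaw A w (i + 1)‖ := by
          rcases eq_or_ne (lanczosRaw A w i) 0 with h0 | h0
          · simp [lanczosRaw_succ_eq_zero A w h0]
          · have : ‖lanczosVec A w i‖ = 1 := by
              rw [lanczosVec, norm_smul, norm_inv, norm_norm,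
                inv_mul_cancel₀ (norm_ne_zero_iff.2 h0)]
            rw [real_inner_self_eq_norm_sq, this, one_pow, mul_one]
        rw [e1, e2] at h
        linarith

/-- The Lanczos vectors are pairwise orthogonal. -/
theorem inner_lanczosVec_of_ne {A : Matrix (Fin n) (Fin n) ℝ} (hA : A.IsSymm)
    (w : EuclideanSpace ℝ (Fin n)) {i j : ℕ} (hij : i ≠ j) :
    inner ℝ (lanczosVec A w i) (lanczosVec A w j) = 0 := by
  have key : ∀ i j, i < j → inner ℝ (lanczosVec A w i) (lanczosVec A w j) = 0 := by
    intro i j h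
    rw [lanczosVec.eq_def A w j, inner_smul_right, inner_lanczosVec_lanczosRaw_of_lt hA w j i h,
      mul_zero]
  rcases lt_or_gt_of_ne hij with h | h
  · exact key i j h
  · rw [real_inner_comm]; exact key j i h

theorem inner_lanczosVec_toEuclideanLin_of_lt {A : Matrix (Fin n) (Fin n) ℝ} (hA : A.IsSymm)
    (w : EuclideanSpace ℝ (Fin n)) {i j : ℕ} (hij : j + 1 < i) :
    inner ℝ (lanczosVec A w i) (Matrix.toEuclideanLin A (lanczosVec A w j)) = 0 := by
  rw [real_inner_comm, inner_toEuclideanLin_lanczosVec A w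
    (fun l hl => inner_lanczosVec_of_ne hA w (by omega)), ← norm_smul_lanczosVec,
    real_inner_smul_left, inner_lanczosVec_of_ne hA w (by omega), mul_zero]

/-- The norms of the Lanczos vectors before normalization are bounded by those of `A q`. -/
theorem norm_lanczosRaw_succ_le {A : Matrix (Fin n) (Fin n) ℝ} (hA : A.IsSymm)
    (w : EuclideanSpace ℝ (Fin n)) (j : ℕ) :
    ‖lanczosRaw A w (j + 1)‖ ≤ ‖Matrix.toEuclideanLin A (lanczosVec A w j)‖ := by
  -- Orthogonality gives `⟪A q, u⟫ = ‖u‖ ^ 2`; Cauchy–Schwarz then yields the claim.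
  have h := inner_toEuclideanLin_lanczosVec A w (j := j) (x := lanczosRaw A w (j + 1))
    fun i hi => inner_lanczosVec_lanczosRaw_of_lt hA w _ i (by omega)
  have h2 := real_inner_le_norm (Matrix.toEuclideanLin A (lanczosVec A w j))
    (lanczosRaw A w (j + 1))
  rw [h, real_inner_self_eq_norm_sq] at h2
  rcases eq_or_ne (‖lanczosRaw A w (j + 1)‖) 0 with h0 | h0
  · rw [h0]; exact norm_nonneg _
  · have : 0 < ‖lanczosRaw A w (j + 1)‖ := lt_of_le_of_ne (norm_nonneg _) h0.symm
    nlinarith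

/-- Expansion of an element of the Krylov subspace in the Lanczos vectors. -/
theorem sum_inner_smul_lanczosVec {A : Matrix (Fin n) (Fin n) ℝ} (hA : A.IsSymm)
    (w : EuclideanSpace ℝ (Fin n)) (m : ℕ) {j : ℕ} (hj : j < m) :
    ∑ i : Fin m, inner ℝ (lanczosVec A w i) (lanczosVec A w j) • lanczosVec A w i
      = lanczosVec A w j := by
  rw [Finset.sum_eq_single (⟨j, hj⟩ : Fin m)]
  · rw [real_inner_self_eq_norm_sq, norm_sq_smul_lanczosVec]
  · intro i _ hi
    rw [inner_lanczosVec_of_ne hA w (fun h => hi (Fin.ext h)), zero_smul]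
  · simp

/-- The Lanczos relation `A V_m = V_m H_m + u_m e_mᵀ`, column by column. -/
theorem toEuclideanLin_lanczosVec_eq_sum {A : Matrix (Fin n) (Fin n) ℝ} (hA : A.IsSymm)
    (w : EuclideanSpace ℝ (Fin n)) (N : ℕ) {j : ℕ} (hj : j ≤ N) :
    Matrix.toEuclideanLin A (lanczosVec A w j) =
      ∑ i : Fin (N + 1), inner ℝ (lanczosVec A w i) (Matrix.toEuclideanLin A (lanczosVec A w j)) •
        lanczosVec A w i + (if j = N then lanczosRaw A w (N + 1) else 0) := by
  -- `P` is the orthogonal projection onto the span of the first `N + 1` Lanczos vectors. It fixes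
  -- every term of the recurrence except `u (N+1)`, which it kills.
  let P : EuclideanSpace ℝ (Fin n) →ₗ[ℝ] EuclideanSpace ℝ (Fin n) :=
    ∑ i : Fin (N + 1), (innerₛₗ ℝ (lanczosVec A w i)).smulRight (lanczosVec A w i)
  have hP : ∀ x, P x = ∑ i : Fin (N + 1), inner ℝ (lanczosVec A w i) x • lanczosVec A w i := by
    intro x; simp [P, LinearMap.sum_apply]
  have hq : ∀ i ≤ N, P (lanczosVec A w i) = lanczosVec A w i := fun i hi => by
    rw [hP]; exact sum_inner_smul_lanczosVec hA w (N + 1) (by omega)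
  have hu : P (lanczosRaw A w (j + 1)) + (if j = N then lanczosRaw A w (N + 1) else 0)
      = lanczosRaw A w (j + 1) := by
    split_ifs with h
    · subst h
      rw [hP, Finset.sum_eq_zero, zero_add]
      intro i _
      rw [inner_lanczosVec_lanczosRaw_of_lt hA w _ i i.2, zero_smul]
    · rw [add_zero, ← norm_smul_lanczosVec, map_smul, hq _ (by omega)]
  rw [← hP]
  cases j with
  | zero =>
    conv_rhs => rw [toEuclideanLin_lanczosVec_zero]
    rw [map_add, map_smul, hq 0 hj, add_assoc, hu]
    exact toEuclideanLin_lanczosVec_zero A w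
  | succ j =>
    conv_rhs => rw [toEuclideanLin_lanczosVec_succ]
    rw [map_add, map_add, map_smul, map_smul, hq _ hj, hq j (by omega), add_assoc, hu]
    exact toEuclideanLin_lanczosVec_succ A w j

end LanczosProcess

/-! ### Spectral decomposition of a real symmetric matrix -/

section SpectralDecomposition

variable {ι : Type*} [Fintype ι] [DecidableEq ι] {H : Matrix ι ι ℝ}

theorem Matrix.IsHermitian.toEuclideanLin_eigenvectorBasis (hH : H.IsHermitian) (j : ι) :
    Matrix.toEuclideanLin H (hH.eigenvectorBasis j)
      = hH.eigenvalues j • hH.eigenvectorBasis j := by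
  rw [Matrix.toLpLin_apply, hH.mulVec_eigenvectorBasis]
  rfl

/-- The functional calculus of a symmetric matrix, entry by entry. -/
theorem Matrix.IsHermitian.cfc_apply_eq_sum (hH : H.IsHermitian) (f : ℝ → ℝ) (i k : ι) :
    cfc f H i k = ∑ j, f (hH.eigenvalues j) * (hH.eigenvectorBasis j i * hH.eigenvectorBasis j k) := by
  rw [hH.cfc_eq, Matrix.IsHermitian.cfc, Unitary.conjStarAlgAut_apply, Matrix.mul_apply]
  refine Finset.sum_congr rfl fun j _ => ?_
  rw [Matrix.mul_diagonal, Matrix.star_apply]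
  simp
  ring

/-- Identifies the moments of the spectral measure with entries of powers, so that sparsity of `H`
becomes vanishing of moments. -/
theorem Matrix.IsHermitian.pow_apply_eq_sum (hH : H.IsHermitian) (p : ℕ) (i k : ι) :
    (H ^ p) i k =
      ∑ j, (hH.eigenvectorBasis j i * hH.eigenvectorBasis j k) * hH.eigenvalues j ^ p := by
  have hs : IsSelfAdjoint H := hH
  rw [← cfc_pow_id (R := ℝ) H p, hH.cfc_apply_eq_sum]
  exact Finset.sum_congr rfl fun j _ => mul_comm _ _

/-- The rows of the orthogonal eigenvector matrix are unit vectors (the case `H ^ 0 = 1` above), and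
`|ab| ≤ (a² + b²) / 2`. -/
theorem Matrix.IsHermitian.sum_abs_eigenvectorBasis_mul_le (hH : H.IsHermitian) (i k : ι) :
    ∑ j, |hH.eigenvectorBasis j i * hH.eigenvectorBasis j k| ≤ 1 := by
  have h1 : ∀ i, ∑ j, hH.eigenvectorBasis j i * hH.eigenvectorBasis j i = 1 := fun i => by
    have := hH.pow_apply_eq_sum 0 i i
    simpa using this.symm
  have h2 : ∀ j, |hH.eigenvectorBasis j i * hH.eigenvectorBasis j k|
      ≤ (hH.eigenvectorBasis j i * hH.eigenvectorBasis j i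
        + hH.eigenvectorBasis j k * hH.eigenvectorBasis j k) / 2 := fun j => by
    rw [abs_le]
    constructor <;>
    nlinarith [sq_nonneg (hH.eigenvectorBasis j i - hH.eigenvectorBasis j k),
      sq_nonneg (hH.eigenvectorBasis j i + hH.eigenvectorBasis j k)]
  refine (Finset.sum_le_sum fun j _ => h2 j).trans ?_
  rw [← Finset.sum_div, Finset.sum_add_distrib, h1, h1]
  norm_num

theorem Matrix.IsHermitian.inner_toEuclideanLin_eq_sum (hH : H.IsHermitian)
    (x : EuclideanSpace ℝ ι) :
    inner ℝ x (Matrix.toEuclideanLin H x)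
      = ∑ j, hH.eigenvalues j * (inner ℝ (hH.eigenvectorBasis j) x) ^ 2 := by
  rw [← hH.eigenvectorBasis.sum_inner_mul_inner]
  refine Finset.sum_congr rfl fun j _ => ?_
  have hs := Matrix.isSymmetric_toEuclideanLin_iff.2 hH
  rw [← hs, hH.toEuclideanLin_eigenvectorBasis, real_inner_smul_left, real_inner_comm]
  ring

theorem Matrix.IsHermitian.norm_toEuclideanLin_sq_eq_sum (hH : H.IsHermitian)
    (x : EuclideanSpace ℝ ι) :
    ‖Matrix.toEuclideanLin H x‖ ^ 2
      = ∑ j, hH.eigenvalues j ^ 2 * (inner ℝ (hH.eigenvectorBasis j) x) ^ 2 := by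
  rw [← hH.eigenvectorBasis.sum_sq_norm_inner_right]
  refine Finset.sum_congr rfl fun j _ => ?_
  have hs := Matrix.isSymmetric_toEuclideanLin_iff.2 hH
  rw [← hs, hH.toEuclideanLin_eigenvectorBasis, real_inner_smul_left, Real.norm_eq_abs, sq_abs, mul_pow]

theorem Matrix.IsHermitian.inner_toEuclideanLin_nonneg (hH : H.IsHermitian)
    (hspec : spectrum ℝ H ⊆ Set.Icc (0 : ℝ) 1) (x : EuclideanSpace ℝ ι) :
    0 ≤ inner ℝ x (Matrix.toEuclideanLin H x) := by
  rw [hH.inner_toEuclideanLin_eq_sum]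
  exact Finset.sum_nonneg fun j _ =>
    mul_nonneg (hspec (hH.eigenvalues_mem_spectrum_real j)).1 (sq_nonneg _)

theorem Matrix.IsHermitian.norm_toEuclideanLin_le (hH : H.IsHermitian)
    (hspec : spectrum ℝ H ⊆ Set.Icc (0 : ℝ) 1) (x : EuclideanSpace ℝ ι) :
    ‖Matrix.toEuclideanLin H x‖ ≤ ‖x‖ := by
  refine le_of_sq_le_sq ?_ (norm_nonneg _)
  rw [hH.norm_toEuclideanLin_sq_eq_sum, ← hH.eigenvectorBasis.sum_sq_norm_inner_right]
  refine Finset.sum_le_sum fun j _ => ?_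
  have h := hspec (hH.eigenvalues_mem_spectrum_real j)
  rw [Real.norm_eq_abs, sq_abs]
  exact mul_le_of_le_one_left (sq_nonneg _) (pow_le_one₀ h.1 h.2)

end SpectralDecomposition

/-! ### The scalar oscillator equation -/

section SecondDerivative

theorem mul_sigmaFun_sq (t : ℝ) {s : ℝ} (hs : s ≠ 0) :
    t * sigmaFun (t ^ 2 * s ^ 2) = Real.sin (t * s) / s := by
  rw [← mul_pow, sigmaFun_sq]
  rcases eq_or_ne t 0 with rfl | ht
  · simp
  · rw [Real.sinc_of_ne_zero (mul_ne_zero ht hs)]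
    field_simp

/-- For `z = s²` with `s > 0` the function is `sin (t s) / s`; for `z = 0` it is `t`. -/
theorem exists_hasDerivAt_mul_sigmaFun {z : ℝ} (hz : 0 ≤ z) :
    ∃ g : ℝ → ℝ, (∀ t, HasDerivAt (fun t => t * sigmaFun (t ^ 2 * z)) (g t) t) ∧
      ∀ t, HasDerivAt g (-z * (t * sigmaFun (t ^ 2 * z))) t := by
  rcases hz.eq_or_lt with rfl | hz
  · refine ⟨fun _ => 1, fun t => ?_, fun t => by simpa using hasDerivAt_const t (1 : ℝ)⟩
    have : sigmaFun 0 = 1 := by simpa using sigmaFun_sq 0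
    simpa [this] using hasDerivAt_id' t
  · obtain ⟨s, hs, rfl⟩ : ∃ s : ℝ, 0 < s ∧ z = s ^ 2 :=
      ⟨√z, Real.sqrt_pos.2 hz, (Real.sq_sqrt hz.le).symm⟩
    simp_rw [mul_sigmaFun_sq _ hs.ne']
    have hl : ∀ t : ℝ, HasDerivAt (fun t => t * s) s t := fun t => by
      simpa using (hasDerivAt_id' t).mul_const s
    refine ⟨fun t => Real.cos (t * s), fun t => ?_, fun t => ?_⟩
    · convert! ((hl t).sin.div_const s) using 1
      field_simp
    · convert! (hl t).cos using 1
      field_simp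

theorem deriv_deriv_sum_mul_sigmaFun_smul {ι E : Type*} [Fintype ι] [NormedAddCommGroup E]
    [NormedSpace ℝ E] {l : ι → ℝ} (hl : ∀ j, 0 ≤ l j) (b : ι → E) (t : ℝ) :
    deriv (deriv fun t => ∑ j, (t * sigmaFun (t ^ 2 * l j)) • b j) t
      = ∑ j, (-l j * (t * sigmaFun (t ^ 2 * l j))) • b j := by
  choose g hg hg' using fun j => exists_hasDerivAt_mul_sigmaFun (hl j)
  have h1 : deriv (fun t => ∑ j, (t * sigmaFun (t ^ 2 * l j)) • b j)
      = fun t => ∑ j, g j t • b j := by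
    funext t
    exact (HasDerivAt.fun_sum fun j _ => (hg j t).smul_const (b j)).deriv
  rw [h1]
  exact (HasDerivAt.fun_sum fun j _ => (hg' j t).smul_const (b j)).deriv

end SecondDerivative

/-! ### The projected matrix and the residual -/

section ProjectedMatrix

variable {n : ℕ}

theorem lanczosH_apply (A : Matrix (Fin n) (Fin n) ℝ) (w : EuclideanSpace ℝ (Fin n)) (m : ℕ)
    (i j : Fin m) :
    lanczosH A w m i j =
      inner ℝ (lanczosVec A w i) (Matrix.toEuclideanLin A (lanczosVec A w j)) := by
  rw [lanczosH, Matrix.mul_assoc, Matrix.mul_apply, PiLp.inner_apply]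
  refine Finset.sum_congr rfl fun k _ => ?_
  rw [Matrix.toLpLin_apply]
  simp [lanczosV, Matrix.mul_apply, Matrix.mulVec, dotProduct, mul_comm]

theorem isHermitian_lanczosH {A : Matrix (Fin n) (Fin n) ℝ} (hA : A.IsSymm)
    (w : EuclideanSpace ℝ (Fin n)) (m : ℕ) : (lanczosH A w m).IsHermitian := by
  ext i j
  rw [Matrix.conjTranspose_apply, star_trivial, lanczosH_apply, lanczosH_apply,
    ← inner_toEuclideanLin_comm hA, real_inner_comm]

theorem toEuclideanLin_lanczosV (A : Matrix (Fin n) (Fin n) ℝ) (w : EuclideanSpace ℝ (Fin n))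
    (m : ℕ) (x : EuclideanSpace ℝ (Fin m)) :
    Matrix.toEuclideanLin (lanczosV A w m) x = ∑ j, x j • lanczosVec A w j := by
  ext i
  rw [Matrix.toLpLin_apply]
  simp [lanczosV, Matrix.mulVec, dotProduct, mul_comm]

theorem norm_toEuclideanLin_lanczosV_le {A : Matrix (Fin n) (Fin n) ℝ} (hA : A.IsSymm)
    (w : EuclideanSpace ℝ (Fin n)) (m : ℕ) (x : EuclideanSpace ℝ (Fin m)) :
    ‖Matrix.toEuclideanLin (lanczosV A w m) x‖ ≤ ‖x‖ := by
  refine le_of_sq_le_sq ?_ (norm_nonneg _)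
  rw [EuclideanSpace.real_norm_sq_eq x, ← real_inner_self_eq_norm_sq, toEuclideanLin_lanczosV,
    sum_inner]
  refine Finset.sum_le_sum fun j _ => ?_
  rw [inner_sum, Finset.sum_eq_single j]
  · rw [real_inner_smul_left, real_inner_smul_right, real_inner_self_eq_norm_sq]
    have := pow_le_one₀ (n := 2) (norm_nonneg _) (norm_lanczosVec_le_one A w j)
    nlinarith [sq_nonneg (x j)]
  · intro k _ hk
    rw [real_inner_smul_left, real_inner_smul_right,
      inner_lanczosVec_of_ne hA w (fun h => hk (Fin.ext h.symm))]
    simp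
  · simp

/-- The compressed quadratic form. -/
theorem inner_toEuclideanLin_lanczosH (A : Matrix (Fin n) (Fin n) ℝ)
    (w : EuclideanSpace ℝ (Fin n)) (m : ℕ) (x : EuclideanSpace ℝ (Fin m)) :
    inner ℝ x (Matrix.toEuclideanLin (lanczosH A w m) x) =
      inner ℝ (Matrix.toEuclideanLin (lanczosV A w m) x)
        (Matrix.toEuclideanLin A (Matrix.toEuclideanLin (lanczosV A w m) x)) := by
  rw [toEuclideanLin_lanczosV, map_sum, sum_inner, PiLp.inner_apply]
  refine Finset.sum_congr rfl fun i _ => ?_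
  rw [inner_sum, Matrix.toLpLin_apply]
  simp only [Matrix.mulVec, dotProduct, map_smul, real_inner_smul_left, real_inner_smul_right,
    lanczosH_apply, RCLike.inner_apply, conj_trivial, Finset.sum_mul]
  exact Finset.sum_congr rfl fun k _ => by ring

/-- An eigenvalue is the quadratic form of `A` at the image under `V` of a unit eigenvector. `V` is
a contraction even with zero columns, and these only bring in the eigenvalue `0`, which is still in
the interval. -/
theorem eigenvalues_lanczosH_mem_Icc {A : Matrix (Fin n) (Fin n) ℝ} (hA : A.IsSymm)
    (hspec : spectrum ℝ A ⊆ Set.Icc (0 : ℝ) 1) (w : EuclideanSpace ℝ (Fin n)) (m : ℕ)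
    (j : Fin m) : (isHermitian_lanczosH hA w m).eigenvalues j ∈ Set.Icc (0 : ℝ) 1 := by
  have hAh : A.IsHermitian := by
    rw [Matrix.IsHermitian, Matrix.conjTranspose_eq_transpose_of_trivial]; exact hA
  set hH := isHermitian_lanczosH hA w m
  have h := inner_toEuclideanLin_lanczosH A w m (hH.eigenvectorBasis j)
  rw [hH.toEuclideanLin_eigenvectorBasis, real_inner_smul_right, real_inner_self_eq_norm_sq, hH.eigenvectorBasis.norm_eq_one,
    one_pow, mul_one] at h
  set y := Matrix.toEuclideanLin (lanczosV A w m) (hH.eigenvectorBasis j)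
  have hy : ‖y‖ ≤ 1 := by
    simpa using norm_toEuclideanLin_lanczosV_le hA w m (hH.eigenvectorBasis j)
  rw [h]
  refine ⟨hAh.inner_toEuclideanLin_nonneg hspec y, ?_⟩
  calc inner ℝ y (Matrix.toEuclideanLin A y) ≤ ‖y‖ * ‖Matrix.toEuclideanLin A y‖ :=
        real_inner_le_norm _ _
    _ ≤ 1 * 1 := mul_le_mul hy ((hAh.norm_toEuclideanLin_le hspec y).trans hy)
        (norm_nonneg _) zero_le_one
    _ = 1 := one_mul 1

/-- The entries of the powers of an upper Hessenberg matrix far below the diagonal vanish. -/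
theorem pow_lanczosH_apply_eq_zero {A : Matrix (Fin n) (Fin n) ℝ} (hA : A.IsSymm)
    (w : EuclideanSpace ℝ (Fin n)) (m k : ℕ) (i j : Fin m) (h : (j : ℕ) + k < i) :
    (lanczosH A w m ^ k) i j = 0 := by
  induction k generalizing i with
  | zero =>
    rw [pow_zero, Matrix.one_apply_ne]
    rintro rfl
    omega
  | succ k ih =>
    rw [pow_succ', Matrix.mul_apply]
    refine Finset.sum_eq_zero fun l _ => ?_
    rcases Nat.lt_or_ge ((j : ℕ) + k) l with hl | hl
    · rw [ih l hl, mul_zero]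
    · rw [lanczosH_apply, inner_lanczosVec_toEuclideanLin_of_lt hA w (by omega), zero_mul]

/-- The Lanczos relation `A V_m = V_m H_m + u_m e_mᵀ`. -/
theorem toEuclideanLin_toEuclideanLin_lanczosV {A : Matrix (Fin n) (Fin n) ℝ} (hA : A.IsSymm)
    (w : EuclideanSpace ℝ (Fin n)) (N : ℕ) (x : EuclideanSpace ℝ (Fin (N + 1))) :
    Matrix.toEuclideanLin A (Matrix.toEuclideanLin (lanczosV A w (N + 1)) x) =
      Matrix.toEuclideanLin (lanczosV A w (N + 1))
        (Matrix.toEuclideanLin (lanczosH A w (N + 1)) x)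
      + x (Fin.last N) • lanczosRaw A w (N + 1) := by
  have hlast : ∑ j : Fin (N + 1), x j • (if (j : ℕ) = N then lanczosRaw A w (N + 1) else 0)
      = x (Fin.last N) • lanczosRaw A w (N + 1) := by
    rw [Finset.sum_eq_single (Fin.last N)]
    · simp
    · intro j _ hj
      rw [if_neg (fun h : (j : ℕ) = N => hj (Fin.ext h)), smul_zero]
    · simp
  rw [toEuclideanLin_lanczosV, toEuclideanLin_lanczosV, map_sum, ← hlast]
  simp_rw [map_smul]
  rw [Finset.sum_congr rfl fun j _ => congrArg (x j • ·)
    (toEuclideanLin_lanczosVec_eq_sum hA w N (Nat.lt_succ_iff.1 j.2))]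
  simp_rw [smul_add, Finset.sum_add_distrib, Finset.smul_sum]
  rw [Finset.sum_comm]
  congr 1
  refine Finset.sum_congr rfl fun i _ => ?_
  rw [Matrix.toLpLin_apply]
  simp only [Matrix.mulVec, dotProduct, lanczosH_apply, Finset.sum_smul, smul_smul]
  exact Finset.sum_congr rfl fun j _ => by rw [mul_comm]

/-- The Lanczos approximation in terms of the eigenvectors of `H_m`. -/
theorem lanczosApprox_eq_sum {A : Matrix (Fin n) (Fin n) ℝ} (hA : A.IsSymm)
    {w : EuclideanSpace ℝ (Fin n)} (hw : ‖w‖ = 1) (N : ℕ) (t : ℝ) :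
    lanczosApprox A w (N + 1) t =
      ∑ j, (t * sigmaFun (t ^ 2 * (isHermitian_lanczosH hA w (N + 1)).eigenvalues j)) •
        ((isHermitian_lanczosH hA w (N + 1)).eigenvectorBasis j 0 •
          Matrix.toEuclideanLin (lanczosV A w (N + 1))
            ((isHermitian_lanczosH hA w (N + 1)).eigenvectorBasis j)) := by
  set hH := isHermitian_lanczosH hA w (N + 1)
  have e1 : (fun i : Fin (N + 1) => if (i : ℕ) = 0 then ‖w‖ else 0) = Pi.single 0 1 := by
    funext i
    rw [hw, Pi.single_apply]
    simp only [Fin.ext_iff, Fin.val_zero]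
  rw [lanczosApprox, e1, Matrix.mulVec_single_one, ← Matrix.toLin'_apply,
    ← Matrix.toLpLin_toLp 2 2]
  simp_rw [← map_smul]
  rw [← map_sum]
  congr 1
  ext i
  simp only [Matrix.col_apply, WithLp.ofLp_sum, WithLp.ofLp_smul, Finset.sum_apply,
    Pi.smul_apply, smul_eq_mul]
  rw [hH.cfc_apply_eq_sum]
  exact Finset.sum_congr rfl fun j _ => by ring

/-- The residual is a multiple of the next Lanczos vector. -/
theorem lanczosResidual_eq_smul {A : Matrix (Fin n) (Fin n) ℝ} (hA : A.IsSymm)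
    (hspec : spectrum ℝ A ⊆ Set.Icc (0 : ℝ) 1)
    {w : EuclideanSpace ℝ (Fin n)} (hw : ‖w‖ = 1) (N : ℕ) (t : ℝ) :
    lanczosResidual A w (N + 1) t =
      -((∑ j, ((isHermitian_lanczosH hA w (N + 1)).eigenvectorBasis j (Fin.last N) *
          (isHermitian_lanczosH hA w (N + 1)).eigenvectorBasis j 0) *
        (t * sigmaFun (t ^ 2 * (isHermitian_lanczosH hA w (N + 1)).eigenvalues j))) •
          lanczosRaw A w (N + 1)) := by
  rw [lanczosResidual, funext (lanczosApprox_eq_sum hA hw N),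
    deriv_deriv_sum_mul_sigmaFun_smul fun j => (eigenvalues_lanczosH_mem_Icc hA hspec w _ j).1]
  set hH := isHermitian_lanczosH hA w (N + 1)
  rw [map_sum, ← neg_add', ← Finset.sum_add_distrib, Finset.sum_smul]
  congr 1
  refine Finset.sum_congr rfl fun j _ => ?_
  -- On an eigenvector, `V H x` is the eigenvalue times `V x`, which cancels the second derivative;
  -- only the `u` term survives.
  rw [map_smul, map_smul, toEuclideanLin_toEuclideanLin_lanczosV hA,
    hH.toEuclideanLin_eigenvectorBasis, map_smul]
  module

end ProjectedMatrix

theorem proposition3p4 {n : ℕ} (A : Matrix (Fin n) (Fin n) ℝ) (hA : A.IsSymm)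
    (hspec : spectrum ℝ A ⊆ Set.Icc (0 : ℝ) 1)
    (w : EuclideanSpace ℝ (Fin n)) (hw : ‖w‖ = 1)
    (m : ℕ) (hm : 2 ≤ m) (t : ℝ) (ht0 : 0 ≤ t) (ht1 : t ≤ 1) :
    ‖lanczosResidual A w m t‖ ≤ 16 * ((t / 2) ^ (2 * m - 1) / ((2 * m - 1).factorial : ℝ)) := by
  -- `N` is the last index of `H`, hence the number of vanishing corner moments; `m ≥ 2` makes `N ≥
  -- 1`, as the choice `ρ = 2N ≥ 1` requires.
  obtain ⟨N, rfl⟩ : ∃ N, m = N + 1 := ⟨m - 1, by omega⟩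
  have hAh : A.IsHermitian := by
    rw [Matrix.IsHermitian, Matrix.conjTranspose_eq_transpose_of_trivial]; exact hA
  have hu : ‖lanczosRaw A w (N + 1)‖ ≤ 1 :=
    (norm_lanczosRaw_succ_le hA w N).trans
      ((hAh.norm_toEuclideanLin_le hspec _).trans (norm_lanczosVec_le_one A w N))
  have hH := isHermitian_lanczosH hA w (N + 1)
  have hmain := abs_sum_mul_sigmaFun_le
    (hH.sum_abs_eigenvectorBasis_mul_le (Fin.last N) 0)
    (eigenvalues_lanczosH_mem_Icc hA hspec w (N + 1)) (N := N) (by omega)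
    (fun k hk => by
      rw [← hH.pow_apply_eq_sum]
      exact pow_lanczosH_apply_eq_zero hA w _ k _ _ (by simpa using hk)) ht0 ht1
  rw [lanczosResidual_eq_smul hA hspec hw, norm_neg, norm_smul, Real.norm_eq_abs,
    show 2 * (N + 1) - 1 = 2 * N + 1 by omega]
  exact (mul_le_of_le_one_right (abs_nonneg _) hu).trans hmain
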